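/- Let $K$ be a field. For a finite simple graph $G$, the binomial edge ideal of $G$ is $$J_G=\bigl(x_iy_j-x_jy_i \;:\; \{i,j\}\in E(G)\bigr)\subseteq K[x_i,y_i : i\in V(G)],$$ and $J_G$ is called unmixed if all its minimal primes have the same height. A vertex $v$ is a cut vertex of $G$ if $G\setminus\{v\}$ has more connected components than $G$, and $G_v$ denotes the graph obtained from $G$ by adding all edges between distinct neighbours of $v$. Strong unmixedness is defined recursively: $J_G$ is strongly unmixed if every connected component of $G$ is a complete graph, or if $J_G$ is unmixed and there is a cut vertex $v$ of $G$ such that $J_{G\setminus\{v\}}$, $J_{G_v}$ and $J_{G_v\setminus\{v\}}$ are strongly unmixed. Let $m,n,r$ be integers with $1\le r\le m$ and $1\le r\le n$. Let $K_m\star_r K_n$ be the graph consisting of two disjoint complete graphs on $\{x_1,\dots,x_m\}$ and $\{y_1,\dots,y_n\}$ together with the edges $\{x_i,y_i\}$ for $1\le i\le r$. Let $\overline{K_m\star_r K_n}$ be the graph obtained from it by adding, for each $2\le i\le r$, two new vertices $f_{x_i},f_{y_i}$ and the edges $\{x_i,f_{x_i}\}$ and $\{y_i,f_{y_i}\}$.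 **Theorem.** The binomial edge ideal $J_{\overline{K_m\star_r K_n}}$ is strongly unmixed. -/

import Mathlib

universe u v

namespace BinomialEdge

/-- The number of connected components of a (finite) graph. -/
noncomputable def numComponents {V : Type u} (G : SimpleGraph V) : ℕ :=
  Nat.card G.ConnectedComponent

/-- `G ∖ {v}`: the induced subgraph on all vertices other than `v`. -/
abbrev deleteVertex {V : Type u} (G : SimpleGraph V) (v : V) :
    SimpleGraph ({v}ᶜ : Set V) :=
  G.induce ({v}ᶜ : Set V)

/-- `v` is a cut vertex of the finite graph `G` if removing `v` from `G` increases the number of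
connected components. -/
def IsCutVertex {V : Type u} (G : SimpleGraph V) (v : V) : Prop :=
  numComponents G < numComponents (deleteVertex G v)

/-- The graph `G_v`: same vertices as `G`, and in addition to the edges of `G` all edges
`{a, b}` with `a ≠ b` neighbours of `v`. -/
def completeAt {V : Type u} (G : SimpleGraph V) (v : V) : SimpleGraph V where
  Adj a b := G.Adj a b ∨ (a ≠ b ∧ G.Adj v a ∧ G.Adj v b)
  symm := ⟨fun _ _ h => h.imp (fun h => h.symm) fun h => ⟨h.1.symm, h.2.2, h.2.1⟩⟩
  loopless := ⟨fun _ h => h.elim (fun h => h.ne rfl) fun h => h.1 rfl⟩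

/-- The binomial edge ideal `J_G` in the polynomial ring over `K` with variables
`x_i = X (Sum.inl i)` and `y_i = X (Sum.inr i)`, `i` a vertex. It is generated by the binomials
`x_i y_j - x_j y_i` for the edges `{i, j}`; exchanging `i` and `j` only changes the sign of a
generator, so that no ordering of the vertices is needed. -/
noncomputable def binomialEdgeIdeal (K : Type v) [Field K] {V : Type u} (G : SimpleGraph V) :
    Ideal (MvPolynomial (V ⊕ V) K) :=
  Ideal.span {f | ∃ i j : V, G.Adj i j ∧
    f = MvPolynomial.X (Sum.inl i) * MvPolynomial.X (Sum.inr j) -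
      MvPolynomial.X (Sum.inl j) * MvPolynomial.X (Sum.inr i)}

/-- An ideal is unmixed if all its minimal primes have the same height. -/
def IsUnmixed {R : Type*} [CommRing R] (I : Ideal R) : Prop :=
  ∀ p ∈ I.minimalPrimes, ∀ q ∈ I.minimalPrimes, p.height = q.height

/-- `J_G` (over the field `K`, for a finite graph `G`) is strongly unmixed if every connected
component of `G` is a complete graph, or if `J_G` is unmixed and there is a cut vertex `v` of `G`
such that `J_{G ∖ v}`, `J_{G_v}` and `J_{G_v ∖ v}` are strongly unmixed. -/
inductive StronglyUnmixed (K : Type v) [Field K] : ∀ {V : Type u}, SimpleGraph V → Prop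
  | ofComplete {V : Type u} (G : SimpleGraph V)
      (h : ∀ C : G.ConnectedComponent, C.toSimpleGraph = ⊤) : StronglyUnmixed K G
  | ofCutVertex {V : Type u} (G : SimpleGraph V) (v : V)
      (unmixed : IsUnmixed (binomialEdgeIdeal K G))
      (cut : IsCutVertex G v)
      (delete : StronglyUnmixed K (deleteVertex G v))
      (complete : StronglyUnmixed K (completeAt G v))
      (completeDelete : StronglyUnmixed K (deleteVertex (completeAt G v) v)) :
      StronglyUnmixed K G

/-- The star product of `K_m` and `K_n` with respect to `r`: the disjoint union of the two complete
graphs together with the edges `{x_i, y_i}`, `1 ≤ i ≤ r`. Indices are shifted by one: `x_i` is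
`Sum.inl (i - 1)` and `y_i` is `Sum.inr (i - 1)`. -/
def starProduct (m n r : ℕ) : SimpleGraph (Fin m ⊕ Fin n) where
  Adj
    | Sum.inl i, Sum.inl j => i ≠ j
    | Sum.inr i, Sum.inr j => i ≠ j
    | Sum.inl i, Sum.inr j => i.val = j.val ∧ i.val < r
    | Sum.inr j, Sum.inl i => i.val = j.val ∧ i.val < r
  symm := ⟨by
    rintro (i | i) (j | j) h
    · exact Ne.symm h
    · exact h
    · exact h
    · exact Ne.symm h⟩
  loopless := ⟨by
    rintro (i | i) h
    · exact h rfl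
    · exact h rfl⟩

/-- The graph obtained from `G` by attaching one whisker at each vertex `w ∈ W`, that is, a new
vertex `f_w = Sum.inr w` and the edge `{w, f_w}`. -/
def attachWhiskers {V : Type u} (G : SimpleGraph V) (W : Set V) : SimpleGraph (V ⊕ W) where
  Adj
    | Sum.inl a, Sum.inl b => G.Adj a b
    | Sum.inl a, Sum.inr w => a = w
    | Sum.inr w, Sum.inl a => a = w
    | Sum.inr _, Sum.inr _ => False
  symm := ⟨by
    rintro (a | a) (b | b) h
    · exact SimpleGraph.Adj.symm h
    · exact h
    · exact h
    · exact h⟩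
  loopless := ⟨by
    rintro (a | a) h
    · exact G.loopless.irrefl a h
    · exact h⟩

/-- The vertices `x_i`, `y_i` with `2 ≤ i ≤ r` of the star product (with indices shifted by
one). -/
def whiskerVertices (m n r : ℕ) : Set (Fin m ⊕ Fin n) :=
  {a | match a with
    | Sum.inl i => 1 ≤ i.val ∧ i.val < r
    | Sum.inr j => 1 ≤ j.val ∧ j.val < r}

/-- The star product of `K_m` and `K_n` with respect to `r`, with whiskers attached at `x_i` and
`y_i` for `2 ≤ i ≤ r`. -/
def whiskeredStarProduct (m n r : ℕ) :
    SimpleGraph ((Fin m ⊕ Fin n) ⊕ whiskerVertices m n r) :=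
  attachWhiskers (starProduct m n r) (whiskerVertices m n r)

end BinomialEdge

/-!
The proof separates the algebra of minimal primes from a recursion on graphs.

Algebra. For a set `T` of vertices and a labelling `b` of the vertices, `blockPrime K T b` is the
kernel of the map that kills `x_v, y_v` for `v ∈ T` and sends `x_v, y_v` to `u_v s_{b v}`,
`u_v t_{b v}` otherwise. This is the prime generated by the variables of `T` and the `2`-minors of
each block, but the argument never needs generators: `blockPrime_le` bounds it from above by
factoring the quotient map of a prime through the parametrization. Every minimal prime of `J_G`
is `blockPrime K T b` where `b` labels the connected components of `G ∖ T`, and minimality forces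
every vertex of `T` to meet at least two of these components
(`exists_isCutSet_of_mem_minimalPrimes`). The height is `|V| + |T| - c(G ∖ T)`, where `c` counts
components: the upper bound is Krull's height theorem, the lower bound comes from an explicit chain
of primes of the same form (`IsCutSet.height_blockPrime`). Hence `J_G` is unmixed as soon as
`c(G ∖ T) = c(G) + |T|` for all such `T` (`CutSetsUnmixed.isUnmixed`).

Recursion. If the removal of `v` splits its component into exactly two, this combinatorial condition
passes from `G ∖ v` and `G_v` to `G`. So unmixedness need not be checked separately: a graph is
strongly unmixed if it can be decomposed recursively at vertices of this kind (`Splittable`,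
`Splittable.stronglyUnmixed`).

The graph at hand. The class `IsWhiskeredCliques` consists of graphs with whiskers attached to a
core that is a clique, or a union of two cliques `A ∋ a` and `B ∋ b` in which all common vertices,
and both ends of all edges between `A` and `B` other than `{a, b}`, are whiskered. It contains the
whiskered star product, with `a = x_1` and `b = y_1`, and for a whiskered vertex `v` with whisker
`f` it is stable under `G ∖ v`, `G_v` and `G_v ∖ v`, where in `G_v` the vertex `f` joins the core.
Splitting at whiskered vertices ends in a clique or in two cliques joined by an edge, up to isolated
vertices, and these are `Splittable` directly.
-/

namespace BinomialEdge

open MvPolynomial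

/-! ### Primes attached to labelled vertex sets -/

section BlockPrimes

variable (K : Type v) [Field K] {V : Type u}

/-- The binomial `x_i y_j - x_j y_i`. -/
noncomputable def minor (i j : V) : MvPolynomial (V ⊕ V) K :=
  X (Sum.inl i) * X (Sum.inr j) - X (Sum.inl j) * X (Sum.inr i)

open Classical in
/-- The parametrization attached to a set `T` of vertices and a labelling `b` of the vertices: it
sends `x_v, y_v` to `0` for `v ∈ T`, and to `u_v s_{b v}`, `u_v t_{b v}` for `v ∉ T`. In the target
ring `s_l`, `t_l` and `u_v` are the variables indexed by `Sum.inl l`, `Sum.inr (Sum.inl l)` and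
`Sum.inr (Sum.inr v)`. -/
noncomputable def blockHom (T : Set V) (b : V → V) :
    MvPolynomial (V ⊕ V) K →ₐ[K] MvPolynomial (V ⊕ V ⊕ V) K :=
  aeval (Sum.elim
    (fun v => if v ∈ T then 0 else X (Sum.inr (Sum.inr v)) * X (Sum.inl (b v)))
    (fun v => if v ∈ T then 0 else X (Sum.inr (Sum.inr v)) * X (Sum.inr (Sum.inl (b v)))))

/-- The prime ideal generated by the variables `x_v, y_v` with `v ∈ T` and the binomials of all
pairs of vertices outside `T` that carry the same label. It is defined as the kernel of a map to a
domain, so that primality is immediate. -/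
noncomputable def blockPrime (T : Set V) (b : V → V) : Ideal (MvPolynomial (V ⊕ V) K) :=
  RingHom.ker (blockHom K T b)

instance (T : Set V) (b : V → V) : (blockPrime K T b).IsPrime :=
  RingHom.ker_isPrime _

variable {K} {T T' : Set V} {b b' : V → V}

lemma X_inl_mem_blockPrime {v : V} : X (Sum.inl v) ∈ blockPrime K T b ↔ v ∈ T := by
  by_cases h : v ∈ T <;> simp [blockPrime, blockHom, RingHom.mem_ker, h, X_ne_zero]

lemma X_inr_mem_blockPrime {v : V} : X (Sum.inr v) ∈ blockPrime K T b ↔ v ∈ T := by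
  by_cases h : v ∈ T <;> simp [blockPrime, blockHom, RingHom.mem_ker, h, X_ne_zero]

lemma minor_mem_blockPrime {v w : V} :
    minor K v w ∈ blockPrime K T b ↔ v ∈ T ∨ w ∈ T ∨ b v = b w := by
  by_cases hv : v ∈ T
  · simp [minor, blockPrime, blockHom, RingHom.mem_ker, hv]
  by_cases hw : w ∈ T
  · simp [minor, blockPrime, blockHom, RingHom.mem_ker, hw]
  simp only [minor, blockPrime, blockHom, RingHom.mem_ker, hv, hw, false_or, map_sub, map_mul,
    aeval_X, Sum.elim_inl, Sum.elim_inr, if_false]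
  refine ⟨fun h => ?_, fun h => by rw [h]; ring⟩
  classical
  by_contra hne
  -- Specialize `s` to the indicator of the label of `v` and all other variables to `1`.
  have := congrArg (eval (Sum.elim (Pi.single (b v) 1) 1)) h
  simp [Pi.single_eq_of_ne (Ne.symm hne)] at this

lemma exists_eq_mul_of_det_eq_zero {L : Type*} [Field L] {x y x' y' : L}
    (h : x * y' - x' * y = 0) (h0 : ¬ (x = 0 ∧ y = 0)) : ∃ c, x' = c * x ∧ y' = c * y := by
  by_cases hx : x = 0
  · have hy : y ≠ 0 := fun hy => h0 ⟨hx, hy⟩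
    refine ⟨y' / y, ?_, (div_mul_cancel₀ _ hy).symm⟩
    rw [div_mul_eq_mul_div, eq_div_iff hy]
    linear_combination -h
  · refine ⟨x' / x, (div_mul_cancel₀ _ hx).symm, ?_⟩
    rw [div_mul_eq_mul_div, eq_div_iff hx]
    linear_combination h

/-- A prime `p` contains `blockPrime K T b` as soon as modulo `p` the vectors `(x_v, y_v)` vanish on
`T` and every block is spanned by the vector of one of its vertices: over the residue field of `p`
the quotient map then factors through the parametrization. -/
lemma blockPrime_le {p : Ideal (MvPolynomial (V ⊕ V) K)} [p.IsPrime] (r : V → V)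
    (hT : ∀ v ∈ T, X (Sum.inl v) ∈ p ∧ X (Sum.inr v) ∈ p)
    (h : ∀ v ∉ T, (X (Sum.inl v) ∈ p ∧ X (Sum.inr v) ∈ p) ∨
      (¬ (X (Sum.inl (r (b v))) ∈ p ∧ X (Sum.inr (r (b v))) ∈ p) ∧ minor K (r (b v)) v ∈ p)) :
    blockPrime K T b ≤ p := by
  classical
  let L := FractionRing (MvPolynomial (V ⊕ V) K ⧸ p)
  let ψ : MvPolynomial (V ⊕ V) K →ₐ[K] L :=
    (IsScalarTower.toAlgHom K (MvPolynomial (V ⊕ V) K ⧸ p) L).comp (Ideal.Quotient.mkₐ K p)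
  have hψ (f) : ψ f = 0 ↔ f ∈ p := by
    change algebraMap _ L (Ideal.Quotient.mk p f) = 0 ↔ _
    rw [IsFractionRing.to_map_eq_zero_iff, Ideal.Quotient.eq_zero_iff_mem]
  have key (v) : ∃ c : L, v ∉ T → ψ (X (Sum.inl v)) = c * ψ (X (Sum.inl (r (b v)))) ∧
      ψ (X (Sum.inr v)) = c * ψ (X (Sum.inr (r (b v)))) := by
    by_cases hv : v ∈ T
    · exact ⟨0, fun h => absurd hv h⟩
    rcases h v hv with ⟨hx, hy⟩ | ⟨hr, hm⟩
    · exact ⟨0, fun _ => by simp [(hψ _).2 hx, (hψ _).2 hy]⟩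
    obtain ⟨c, hc⟩ := exists_eq_mul_of_det_eq_zero
      (x := ψ (X (Sum.inl (r (b v))))) (y := ψ (X (Sum.inr (r (b v)))))
      (x' := ψ (X (Sum.inl v))) (y' := ψ (X (Sum.inr v)))
      (by simpa [minor] using (hψ _).2 hm) (fun h => hr ⟨(hψ _).1 h.1, (hψ _).1 h.2⟩)
    exact ⟨c, fun _ => hc⟩
  choose c hc using key
  let e : MvPolynomial (V ⊕ V ⊕ V) K →ₐ[K] L :=
    aeval (Sum.elim (fun l => ψ (X (Sum.inl (r l)))) (Sum.elim (fun l => ψ (X (Sum.inr (r l)))) c))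
  have he : e.comp (blockHom K T b) = ψ := by
    refine algHom_ext fun i => ?_
    rcases i with v | v <;> by_cases hv : v ∈ T
    · simp [blockHom, hv, (hψ _).2 (hT v hv).1]
    · simp [blockHom, hv, e, (hc v hv).1]
    · simp [blockHom, hv, (hψ _).2 (hT v hv).2]
    · simp [blockHom, hv, e, (hc v hv).2]
  intro f hf
  rw [← hψ, ← he, AlgHom.comp_apply, (RingHom.mem_ker).1 hf, map_zero]

lemma blockPrime_mono (hT : T' ⊆ T) (hb : ∀ v ∉ T, ∀ w ∉ T, b' v = b' w → b v = b w) :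
    blockPrime K T' b' ≤ blockPrime K T b := by
  classical
  refine blockPrime_le (fun l => if h : ∃ w ∉ T, b' w = l then h.choose else l)
    (fun v hv => ⟨X_inl_mem_blockPrime.2 (hT hv), X_inr_mem_blockPrime.2 (hT hv)⟩)
    fun v _ => ?_
  by_cases hv : v ∈ T
  · exact Or.inl ⟨X_inl_mem_blockPrime.2 hv, X_inr_mem_blockPrime.2 hv⟩
  have hex : ∃ w ∉ T, b' w = b' v := ⟨v, hv, rfl⟩
  rw [dif_pos hex]
  refine Or.inr ⟨fun h => hex.choose_spec.1 (X_inl_mem_blockPrime.1 h.1), ?_⟩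
  exact minor_mem_blockPrime.2
    (Or.inr (Or.inr (hb _ hex.choose_spec.1 _ hv hex.choose_spec.2)))

/-- Split off singletons from the blocks, one at a time, until the labelling is injective. -/
lemma card_le_height_blockPrime_empty [Finite V] (b : V → V) :
    (Nat.card V : ℕ∞) ≤ (blockPrime K ∅ b).height + (Set.range b).ncard := by
  classical
  generalize hk : Nat.card V - (Set.range b).ncard = k
  induction k generalizing b with
  | zero =>
    have : Nat.card V ≤ (Set.range b).ncard := by omega
    exact le_add_left (by exact_mod_cast this)
  | succ k ih =>
    have hlt : (Set.range b).ncard < Nat.card V := by omega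
    have hni : ¬ Function.Injective b := fun hi => by
      rw [Set.ncard_range_of_injective hi] at hlt
      exact lt_irrefl _ hlt
    have hns : ¬ Function.Surjective b := fun hs => hni (Finite.injective_iff_surjective.2 hs)
    obtain ⟨i, j, hij, hne⟩ : ∃ i j, b i = b j ∧ i ≠ j := by
      simpa [Function.Injective] using hni
    obtain ⟨l, hl⟩ : ∃ l, ∀ v, b v ≠ l := by simpa [Function.Surjective] using hns
    have hran : Set.range (Function.update b i l) = insert l (Set.range b) := by
      ext z
      constructor
      · rintro ⟨v, rfl⟩
        rcases eq_or_ne v i with rfl | hv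
        · simp
        · simp [Function.update_of_ne hv]
      · rintro (rfl | ⟨v, rfl⟩)
        · exact ⟨i, by simp⟩
        · rcases eq_or_ne v i with rfl | hv
          · exact ⟨j, by rw [Function.update_of_ne hne.symm, hij]⟩
          · exact ⟨v, Function.update_of_ne hv _ _⟩
    have hcard : (Set.range (Function.update b i l)).ncard = (Set.range b).ncard + 1 := by
      rw [hran, Set.ncard_insert_of_notMem (by rintro ⟨v, hv⟩; exact hl v hv)]
    have hlt' : blockPrime K ∅ (Function.update b i l) < blockPrime K ∅ b := by
      refine lt_of_le_of_ne (blockPrime_mono subset_rfl fun v _ w _ h => ?_) fun h => ?_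
      · rcases eq_or_ne v i with hv | hv <;> rcases eq_or_ne w i with hw | hw
        · rw [hv, hw]
        · rw [hv, Function.update_self, Function.update_of_ne hw] at h
          exact absurd h.symm (hl w)
        · rw [hw, Function.update_self, Function.update_of_ne hv] at h
          exact absurd h (hl v)
        · rwa [Function.update_of_ne hv, Function.update_of_ne hw] at h
      · have hm : minor K i j ∈ blockPrime K ∅ b := minor_mem_blockPrime.2 (by simp [hij])
        rw [← h, minor_mem_blockPrime, Function.update_self, Function.update_of_ne hne.symm] at hm
        exact hl j (by simpa [eq_comm] using hm)
    calc (Nat.card V : ℕ∞)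
        ≤ (blockPrime K ∅ (Function.update b i l)).height +
            (Set.range (Function.update b i l)).ncard := ih _ (by omega)
      _ = ((blockPrime K ∅ (Function.update b i l)).height + 1) + (Set.range b).ncard := by
          rw [hcard]; push_cast; ring
      _ ≤ _ := by gcongr; exact Ideal.height_add_one_le_of_lt_of_isPrime hlt'

/-- Move the vertices of `T`, one at a time, into an existing block. -/
lemma card_add_ncard_le_height_blockPrime [Finite V] (T : Set V) (b : V → V)
    (hT : T.Nonempty → Tᶜ.Nonempty) :
    (Nat.card V + T.ncard : ℕ∞) ≤ (blockPrime K T b).height + (b '' Tᶜ).ncard := by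
  classical
  induction T, Set.toFinite T using Set.Finite.induction_on generalizing b with
  | empty => simpa using card_le_height_blockPrime_empty (K := K) b
  | @insert i T hi _ ih =>
    obtain ⟨j, hj⟩ := hT (Set.insert_nonempty _ _)
    have hji : j ≠ i := fun h => hj (h ▸ Set.mem_insert _ _)
    have hjT : j ∉ T := fun h => hj (Set.mem_insert_of_mem _ h)
    have him : Function.update b i (b j) '' Tᶜ = b '' (insert i T)ᶜ := by
      ext z
      constructor
      · rintro ⟨v, hv, rfl⟩
        rcases eq_or_ne v i with rfl | hvi
        · exact ⟨j, hj, by simp⟩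
        · exact ⟨v, by simp_all, by rw [Function.update_of_ne hvi]⟩
      · rintro ⟨v, hv, rfl⟩
        have hvi : v ≠ i := fun h => hv (h ▸ Set.mem_insert _ _)
        exact ⟨v, fun h => hv (Set.mem_insert_of_mem _ h), by rw [Function.update_of_ne hvi]⟩
    have hlt : blockPrime K T (Function.update b i (b j)) < blockPrime K (insert i T) b := by
      refine lt_of_le_of_ne (blockPrime_mono (Set.subset_insert _ _) fun v hv w hw h => ?_)
        fun h => ?_
      · have hvi : v ≠ i := fun h => hv (h ▸ Set.mem_insert _ _)
        have hwi : w ≠ i := fun h => hw (h ▸ Set.mem_insert _ _)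
        rwa [Function.update_of_ne hvi, Function.update_of_ne hwi] at h
      · have hm : X (Sum.inl i) ∈ blockPrime K (insert i T) b :=
          X_inl_mem_blockPrime.2 (Set.mem_insert _ _)
        rw [← h, X_inl_mem_blockPrime] at hm
        exact hi hm
    have := ih (Function.update b i (b j)) (fun _ => ⟨j, hjT⟩)
    rw [him] at this
    rw [Set.ncard_insert_of_notMem hi]
    calc (Nat.card V + (T.ncard + 1 : ℕ) : ℕ∞) = (Nat.card V + T.ncard) + 1 := by push_cast; ring
      _ ≤ ((blockPrime K T (Function.update b i (b j))).height + (b '' (insert i T)ᶜ).ncard) + 1 := by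
          gcongr
      _ = ((blockPrime K T (Function.update b i (b j))).height + 1) + (b '' (insert i T)ᶜ).ncard := by
          ring
      _ ≤ _ := by gcongr; exact Ideal.height_add_one_le_of_lt_of_isPrime hlt

/-- If every label is a vertex of its own block, `blockPrime K T b` is minimal over the ideal
generated by the variables of `T` and the binomials that pair a vertex with its label, and Krull's
height theorem applies. -/
lemma height_blockPrime_add_le [Finite V] (T : Set V) (b : V → V)
    (hb : ∀ v ∉ T, b v ∉ T ∧ b (b v) = b v) :
    (blockPrime K T b).height + (b '' Tᶜ).ncard ≤ (Nat.card V + T.ncard : ℕ∞) := by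
  classical
  set S : Set (MvPolynomial (V ⊕ V) K) :=
    ((fun v => X (Sum.inl v)) '' T ∪ (fun v => X (Sum.inr v)) '' T) ∪
      (fun v => minor K (b v) v) '' (Tᶜ \ b '' Tᶜ) with hS
  have hmin : blockPrime K T b ∈ (Ideal.span S).minimalPrimes := by
    refine ⟨⟨inferInstance, Ideal.span_le.2 ?_⟩, fun p hp hle => ?_⟩
    · rintro f ((⟨v, hv, rfl⟩ | ⟨v, hv, rfl⟩) | ⟨v, hv, rfl⟩)
      · exact X_inl_mem_blockPrime.2 hv
      · exact X_inr_mem_blockPrime.2 hv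
      · exact minor_mem_blockPrime.2 (Or.inr (Or.inr (hb v hv.1).2))
    · have := hp.1
      have hSp : S ⊆ p := Ideal.span_le.1 hp.2
      refine blockPrime_le id (fun v hv => ⟨hSp (Or.inl (Or.inl ⟨v, hv, rfl⟩)),
        hSp (Or.inl (Or.inr ⟨v, hv, rfl⟩))⟩) fun v hv => Or.inr ⟨fun h => ?_, ?_⟩
      · exact (hb v hv).1 (X_inl_mem_blockPrime.1 (hle h.1))
      · by_cases hvb : v ∈ b '' Tᶜ
        · obtain ⟨w, hw, rfl⟩ := hvb
          simp [minor, (hb w hw).2]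
        · exact hSp (Or.inr ⟨v, ⟨hv, hvb⟩, rfl⟩)
  have h1 := Ideal.height_le_card_of_mem_minimalPrimes_span (Set.toFinite S) hmin
  have hsub : b '' Tᶜ ⊆ Tᶜ := by
    rintro _ ⟨v, hv, rfl⟩
    exact (hb v hv).1
  have h2 : S.ncard ≤ (T.ncard + T.ncard) + (Tᶜ \ b '' Tᶜ).ncard :=
    (Set.ncard_union_le _ _).trans <| add_le_add ((Set.ncard_union_le _ _).trans <|
      add_le_add (Set.ncard_image_le (Set.toFinite _)) (Set.ncard_image_le (Set.toFinite _)))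
      (Set.ncard_image_le (Set.toFinite _))
  have h3 := Set.ncard_sdiff_add_ncard_of_subset hsub
  have h4 := Set.ncard_add_ncard_compl T
  calc (blockPrime K T b).height + (b '' Tᶜ).ncard ≤ (S.ncard : ℕ∞) + (b '' Tᶜ).ncard := by gcongr
    _ ≤ _ := by norm_cast; omega

end BlockPrimes

/-! ### Unmixedness in terms of cut sets -/

section Unmixed

/-- A set `T` of vertices has the cut point property if each of its vertices is joined to at least
two connected components of `G ∖ T`. -/
def IsCutSet {V : Type u} (G : SimpleGraph V) (T : Set V) : Prop :=
  ∀ i ∈ T, ∃ a b : (Tᶜ : Set V), G.Adj i a ∧ G.Adj i b ∧ ¬ (G.induce Tᶜ).Reachable a b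

/-- The combinatorial form of unmixedness: removing a set with the cut point property increases
the number of connected components by the size of the set. -/
def CutSetsUnmixed {V : Type u} (G : SimpleGraph V) : Prop :=
  ∀ T : Set V, IsCutSet G T → numComponents (G.induce Tᶜ) = numComponents G + T.ncard

open Classical in
/-- The labelling of the vertices outside `T` by a chosen vertex of their connected component in
`G ∖ T`. The vertices of `T` are labelled by themselves; these labels play no role. -/
noncomputable def componentLabel {V : Type u} (G : SimpleGraph V) (T : Set V) (v : V) : V :=
  if h : v ∈ Tᶜ then (Quot.out ((G.induce Tᶜ).connectedComponentMk ⟨v, h⟩) : (Tᶜ : Set V)) else v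

variable {V : Type u} {G : SimpleGraph V} {T : Set V}

lemma componentLabel_coe (v : (Tᶜ : Set V)) : componentLabel G T v =
    (Quot.out ((G.induce Tᶜ).connectedComponentMk v) : (Tᶜ : Set V)) := dif_pos v.2

lemma connectedComponentMk_out {W : Type*} {H : SimpleGraph W} (C : H.ConnectedComponent) :
    H.connectedComponentMk (Quot.out C) = C := Quot.out_eq C

lemma componentLabel_eq_iff {v w : (Tᶜ : Set V)} :
    componentLabel G T v = componentLabel G T w ↔ (G.induce Tᶜ).Reachable v w := by
  rw [componentLabel_coe, componentLabel_coe, Subtype.coe_inj, ← SimpleGraph.ConnectedComponent.eq]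
  refine ⟨fun h => ?_, fun h => by rw [h]⟩
  rw [← connectedComponentMk_out ((G.induce Tᶜ).connectedComponentMk v), h,
    connectedComponentMk_out]

lemma componentLabel_spec {v : V} (hv : v ∉ T) : componentLabel G T v ∉ T ∧
    componentLabel G T (componentLabel G T v) = componentLabel G T v := by
  have h := componentLabel_coe (G := G) (⟨v, hv⟩ : (Tᶜ : Set V))
  simp only at h
  rw [h]
  exact ⟨(Quot.out ((G.induce Tᶜ).connectedComponentMk ⟨v, hv⟩)).2,
    by rw [componentLabel_coe, connectedComponentMk_out]⟩

lemma ncard_image_componentLabel :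
    (componentLabel G T '' Tᶜ).ncard = numComponents (G.induce Tᶜ) := by
  have : componentLabel G T '' Tᶜ = Set.range
      (fun C : (G.induce Tᶜ).ConnectedComponent => ((Quot.out C : (Tᶜ : Set V)) : V)) := by
    ext z
    constructor
    · rintro ⟨v, hv, rfl⟩
      exact ⟨_, (componentLabel_coe ⟨v, hv⟩).symm⟩
    · rintro ⟨C, rfl⟩
      refine ⟨_, (Quot.out C).2, ?_⟩
      simp only
      rw [componentLabel_coe, connectedComponentMk_out]
  rw [this, Set.ncard_range_of_injective, numComponents]
  intro C D h
  rw [← connectedComponentMk_out C, Subtype.coe_injective h, connectedComponentMk_out]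

variable {K : Type v} [Field K]

lemma minor_mem_binomialEdgeIdeal {i j : V} (h : G.Adj i j) :
    minor K i j ∈ binomialEdgeIdeal K G := Ideal.subset_span ⟨i, j, h, rfl⟩

lemma binomialEdgeIdeal_le_blockPrime {b : V → V}
    (h : ∀ i ∉ T, ∀ j ∉ T, G.Adj i j → b i = b j) :
    binomialEdgeIdeal K G ≤ blockPrime K T b := by
  refine Ideal.span_le.2 ?_
  rintro _ ⟨i, j, hij, rfl⟩
  refine minor_mem_blockPrime.2 ?_
  by_cases hi : i ∈ T
  · exact Or.inl hi
  by_cases hj : j ∈ T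
  · exact Or.inr (Or.inl hj)
  exact Or.inr (Or.inr (h i hi j hj hij))

/-- A prime containing `J_G` contains the binomials of all pairs of vertices that are connected
through vertices whose two variables do not both lie in the prime. -/
lemma minor_mem_of_reachable {p : Ideal (MvPolynomial (V ⊕ V) K)} [p.IsPrime]
    (hp : binomialEdgeIdeal K G ≤ p)
    (hT : ∀ v ∉ T, ¬ (X (Sum.inl v) ∈ p ∧ X (Sum.inr v) ∈ p)) {v w : (Tᶜ : Set V)}
    (h : (G.induce Tᶜ).Reachable v w) : minor K (v : V) w ∈ p := by
  rw [SimpleGraph.reachable_iff_reflTransGen] at h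
  induction h with
  | refl => simp [minor]
  | @tail a c _ hac ih =>
    have hac' : minor K (a : V) c ∈ p := hp (minor_mem_binomialEdgeIdeal hac)
    have hx : X (Sum.inl (a : V)) * minor K (v : V) c ∈ p := by
      have : X (Sum.inl (a : V)) * minor K (v : V) c =
          X (Sum.inl (v : V)) * minor K (a : V) c + X (Sum.inl (c : V)) * minor K (v : V) a := by
        simp only [minor]; ring
      rw [this]
      exact p.add_mem (p.mul_mem_left _ hac') (p.mul_mem_left _ ih)
    have hy : X (Sum.inr (a : V)) * minor K (v : V) c ∈ p := by
      have : X (Sum.inr (a : V)) * minor K (v : V) c =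
          X (Sum.inr (v : V)) * minor K (a : V) c + X (Sum.inr (c : V)) * minor K (v : V) a := by
        simp only [minor]; ring
      rw [this]
      exact p.add_mem (p.mul_mem_left _ hac') (p.mul_mem_left _ ih)
    by_contra hm
    exact hT a a.2 ⟨(Ideal.IsPrime.mem_or_mem ‹_› hx).resolve_right hm,
      (Ideal.IsPrime.mem_or_mem ‹_› hy).resolve_right hm⟩

/-- The minimal primes of `J_G` are among the primes attached to the sets with the cut point
property: if a vertex of `T` met at most one component of `G ∖ T`, it could be moved from `T` into
that component, which gives a strictly smaller prime above `J_G`. -/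
lemma exists_isCutSet_of_mem_minimalPrimes {p : Ideal (MvPolynomial (V ⊕ V) K)}
    (hp : p ∈ (binomialEdgeIdeal K G).minimalPrimes) :
    ∃ T, IsCutSet G T ∧ p = blockPrime K T (componentLabel G T) := by
  classical
  have := hp.1.1
  set T : Set V := {v | X (Sum.inl v) ∈ p ∧ X (Sum.inr v) ∈ p} with hT
  have hle : blockPrime K T (componentLabel G T) ≤ p := by
    refine blockPrime_le id (fun v hv => hv) fun v hv => Or.inr ⟨?_, ?_⟩
    · exact (componentLabel_spec (G := G) hv).1
    · exact minor_mem_of_reachable (T := T) hp.1.2 (fun _ h => h)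
        (v := ⟨_, (componentLabel_spec (G := G) hv).1⟩) (w := ⟨v, hv⟩)
        (componentLabel_eq_iff.1 (componentLabel_spec hv).2)
  have hmin {T' : Set V} {b : V → V} (hb : ∀ i ∉ T', ∀ j ∉ T', G.Adj i j → b i = b j)
      (h : blockPrime K T' b ≤ p) : p ≤ blockPrime K T' b :=
    hp.2 ⟨inferInstance, binomialEdgeIdeal_le_blockPrime hb⟩ h
  have hlabel : ∀ i ∉ T, ∀ j ∉ T, G.Adj i j → componentLabel G T i = componentLabel G T j :=
    fun i hi j hj hij => componentLabel_eq_iff.2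
      (SimpleGraph.Adj.reachable (G := G.induce Tᶜ) (u := ⟨i, hi⟩) (v := ⟨j, hj⟩) hij)
  have heq := le_antisymm (hmin hlabel hle) hle
  refine ⟨T, fun i hi => ?_, heq⟩
  by_contra! hcon
  -- The label of the only component of `G ∖ T` that `i` meets; if there is none, any label will do.
  let l : V := if h : ∃ a ∉ T, G.Adj i a then componentLabel G T h.choose else i
  have hl : ∀ a ∉ T, G.Adj i a → l = componentLabel G T a := by
    intro a ha hia
    have hex : ∃ a ∉ T, G.Adj i a := ⟨a, ha, hia⟩
    simp only [l, dif_pos hex]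
    exact componentLabel_eq_iff.2 (hcon ⟨_, hex.choose_spec.1⟩ ⟨a, ha⟩ hex.choose_spec.2 hia)
  have hle' := hmin (T' := T \ {i}) (b := Function.update (componentLabel G T) i l) ?_ ?_
  · have : X (Sum.inl i) ∈ p := hi.1
    simpa using X_inl_mem_blockPrime.1 (hle' this)
  · intro a ha c hc hac
    rcases eq_or_ne a i with rfl | hai
    · have hca : c ≠ a := hac.ne'
      rw [Function.update_self, Function.update_of_ne hca]
      exact hl c (fun h => hc ⟨h, hca⟩) hac
    rcases eq_or_ne c i with rfl | hci
    · rw [Function.update_self, Function.update_of_ne hai]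
      exact (hl a (fun h => ha ⟨h, hai⟩) hac.symm).symm
    rw [Function.update_of_ne hai, Function.update_of_ne hci]
    exact hlabel a (fun h => ha ⟨h, hai⟩) c (fun h => hc ⟨h, hci⟩) hac
  · refine le_trans (blockPrime_mono Set.sdiff_subset fun v hv w hw h => ?_) heq.ge
    rwa [Function.update_of_ne (fun h : v = i => hv (h ▸ hi)),
      Function.update_of_ne (fun h : w = i => hw (h ▸ hi))] at h

lemma IsCutSet.height_blockPrime [Finite V] (hT : IsCutSet G T) :
    (blockPrime K T (componentLabel G T)).height + numComponents (G.induce Tᶜ) =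
      (Nat.card V + T.ncard : ℕ∞) := by
  rw [← ncard_image_componentLabel]
  refine le_antisymm (height_blockPrime_add_le _ _ fun v hv => componentLabel_spec hv)
    (card_add_ncard_le_height_blockPrime _ _ ?_)
  rintro ⟨i, hi⟩
  obtain ⟨a, -⟩ := hT i hi
  exact ⟨a, a.2⟩

theorem CutSetsUnmixed.isUnmixed [Finite V] (h : CutSetsUnmixed G) :
    IsUnmixed (binomialEdgeIdeal K G) := by
  have key : ∀ p ∈ (binomialEdgeIdeal K G).minimalPrimes,
      p.height + numComponents G = (Nat.card V : ℕ∞) := by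
    intro p hp
    obtain ⟨T, hT, rfl⟩ := exists_isCutSet_of_mem_minimalPrimes hp
    have hh := hT.height_blockPrime (K := K)
    rw [h T hT, Nat.cast_add, ← add_assoc] at hh
    exact ENat.add_left_injective_of_ne_top (ENat.natCast_ne_top _) hh
  intro p hp q hq
  exact ENat.add_left_injective_of_ne_top (ENat.natCast_ne_top _) ((key p hp).trans (key q hq).symm)

end Unmixed

/-! ### Graphs decomposed by splitting vertices -/

section Splitting

variable {V : Type u} {G : SimpleGraph V} {v : V}

lemma numComponents_congr_of_le {H H' : SimpleGraph V} (hle : H ≤ H')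
    (h : ∀ a b, H'.Adj a b → H.Reachable a b) :
    H.Reachable = H'.Reachable ∧ numComponents H = numComponents H' := by
  have hr : H.Reachable = H'.Reachable := by
    ext a b
    refine ⟨fun hab => hab.mono hle, fun hab => ?_⟩
    rw [SimpleGraph.reachable_iff_reflTransGen] at hab
    induction hab with
    | refl => exact SimpleGraph.Reachable.rfl
    | tail _ hbc ih => exact ih.trans (h _ _ hbc)
  refine ⟨hr, ?_⟩
  simp only [numComponents, SimpleGraph.ConnectedComponent, hr]

lemma numComponents_eq_of_iso {W : Type*} {H : SimpleGraph W} (e : G ≃g H) :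
    numComponents G = numComponents H := Nat.card_congr e.connectedComponentEquiv

lemma le_completeAt (G : SimpleGraph V) (v : V) : G ≤ completeAt G v := fun _ _ h => Or.inl h

/-- As long as `v` is not removed, passing to `G_v` changes no connected component. -/
lemma completeAt_induce {T : Set V} (hv : v ∉ T) :
    (G.induce Tᶜ).Reachable = ((completeAt G v).induce Tᶜ).Reachable ∧
      numComponents (G.induce Tᶜ) = numComponents ((completeAt G v).induce Tᶜ) := by
  refine numComponents_congr_of_le (fun a b h => Or.inl h) fun a b h => ?_
  rcases h with h | ⟨-, ha, hb⟩
  · exact SimpleGraph.Adj.reachable (G := G.induce Tᶜ) h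
  · exact (SimpleGraph.Adj.reachable (G := G.induce Tᶜ) (u := a) (v := ⟨v, hv⟩) ha.symm).trans
      (SimpleGraph.Adj.reachable (G := G.induce Tᶜ) (u := ⟨v, hv⟩) (v := b) hb)

lemma numComponents_completeAt : numComponents (completeAt G v) = numComponents G := by
  refine (numComponents_congr_of_le (le_completeAt G v) fun a b h => ?_).2.symm
  rcases h with h | ⟨-, ha, hb⟩
  · exact h.reachable
  · exact ha.symm.reachable.trans hb.reachable

lemma numComponents_induce_compl_empty :
    numComponents (G.induce (∅ : Set V)ᶜ) = numComponents G := by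
  rw [Set.compl_empty]
  exact numComponents_eq_of_iso (SimpleGraph.induceUnivIso G)

/-- For `v ∈ T`, removing `v` and then the rest of `T` amounts to removing `T`. -/
def deleteVertexInduceIso {T : Set V} (hv : v ∈ T) :
    (deleteVertex G v).induce (Subtype.val ⁻¹' T : Set ({v}ᶜ : Set V))ᶜ ≃g G.induce Tᶜ where
  toFun x := ⟨x.1.1, x.2⟩
  invFun y := ⟨⟨y.1, fun h => y.2 (h ▸ hv)⟩, y.2⟩
  left_inv _ := rfl
  right_inv _ := rfl
  map_rel_iff' := Iff.rfl

lemma ncard_eq_ncard_preimage_add_one [Finite V] {T : Set V} (hv : v ∈ T) :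
    T.ncard = (Subtype.val ⁻¹' T : Set ({v}ᶜ : Set V)).ncard + 1 := by
  have hT : T = insert v (Subtype.val '' (Subtype.val ⁻¹' T : Set ({v}ᶜ : Set V))) := by
    ext x
    by_cases hx : x = v
    · simp [hx, hv]
    · simp [hx]
  conv_lhs => rw [hT]
  rw [Set.ncard_insert_of_notMem (by simp), Set.ncard_image_of_injective _ Subtype.val_injective]

lemma IsCutSet.completeAt {T : Set V} (hT : IsCutSet G T) (hv : v ∉ T) :
    IsCutSet (completeAt G v) T := by
  intro i hi
  obtain ⟨a, b, ha, hb, hab⟩ := hT i hi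
  exact ⟨a, b, Or.inl ha, Or.inl hb, (completeAt_induce (G := G) hv).1 ▸ hab⟩

lemma IsCutSet.deleteVertex {T : Set V} (hT : IsCutSet G T) (hv : v ∈ T) :
    IsCutSet (deleteVertex G v) (Subtype.val ⁻¹' T) := by
  intro i hi
  obtain ⟨a, b, ha, hb, hab⟩ := hT i hi
  let e := deleteVertexInduceIso (G := G) hv
  exact ⟨e.symm a, e.symm b, ha, hb, fun h => hab (e.symm.reachable_iff.1 h)⟩

/-- Removing `v` splits the connected component of `v` into exactly two components, one containing
the neighbour `p` of `v` and the other one containing the neighbour `q`. -/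
structure SplitsAt (G : SimpleGraph V) (v : V) (p q : ({v}ᶜ : Set V)) : Prop where
  adj_left : G.Adj v p
  adj_right : G.Adj v q
  not_reachable : ¬ (deleteVertex G v).Reachable p q
  reachable_or : ∀ w : ({v}ᶜ : Set V), G.Adj v w →
    (deleteVertex G v).Reachable w p ∨ (deleteVertex G v).Reachable w q

open Classical in
lemma SplitsAt.numComponents_deleteVertex [Finite V] {p q : ({v}ᶜ : Set V)}
    (h : SplitsAt G v p q) : numComponents (deleteVertex G v) = numComponents G + 1 := by
  set H := deleteVertex G v with hH
  -- The components of `G` are those of `G ∖ v` other than that of `q`: send a vertex to its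
  -- component in `G ∖ v`, with `v` and the component of `q` redirected to the component of `p`.
  let g : V → H.ConnectedComponent := fun x =>
    if hx : x ∈ ({v}ᶜ : Set V) then
      if H.Reachable ⟨x, hx⟩ q then H.connectedComponentMk p else H.connectedComponentMk ⟨x, hx⟩
    else H.connectedComponentMk p
  have hgv : g v = H.connectedComponentMk p := by simp [g]
  have hgq (x : ({v}ᶜ : Set V)) (hx : H.Reachable x q) : g x = H.connectedComponentMk p := by
    simp only [g]
    rw [dif_pos x.2, if_pos hx]
  have hgn (x : ({v}ᶜ : Set V)) (hx : ¬ H.Reachable x q) : g x = H.connectedComponentMk x := by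
    simp only [g]
    rw [dif_pos x.2, if_neg hx]
  have hgp (x : ({v}ᶜ : Set V)) (hx : H.Reachable x p) : g x = H.connectedComponentMk p := by
    rw [hgn x fun hq => h.not_reachable (hx.symm.trans hq)]
    exact SimpleGraph.ConnectedComponent.eq.2 hx
  have hnbr (x : V) (hx : G.Adj v x) : g x = H.connectedComponentMk p := by
    have hxv : x ∈ ({v}ᶜ : Set V) := hx.ne'
    rcases h.reachable_or ⟨x, hxv⟩ hx with h' | h'
    · exact hgp _ h'
    · exact hgq _ h'
  have hadj (x y : V) (hxy : G.Adj x y) : g x = g y := by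
    rcases eq_or_ne x v with rfl | hx
    · rw [hgv, hnbr y hxy]
    rcases eq_or_ne y v with rfl | hy
    · rw [hgv, hnbr x hxy.symm]
    have hr : H.Reachable ⟨x, hx⟩ ⟨y, hy⟩ :=
      SimpleGraph.Adj.reachable (G := H) (u := ⟨x, hx⟩) (v := ⟨y, hy⟩) hxy
    by_cases hq : H.Reachable ⟨y, hy⟩ q
    · rw [hgq ⟨y, hy⟩ hq, hgq ⟨x, hx⟩ (hr.trans hq)]
    · rw [hgn ⟨y, hy⟩ hq, hgn ⟨x, hx⟩ fun h => hq (hr.symm.trans h)]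
      exact SimpleGraph.ConnectedComponent.eq.2 hr
  have hreach (x y : V) (hxy : G.Reachable x y) : g x = g y := by
    rw [SimpleGraph.reachable_iff_reflTransGen] at hxy
    induction hxy with
    | refl => rfl
    | tail _ hbc ih => exact ih.trans (hadj _ _ hbc)
  have hval {x y : ({v}ᶜ : Set V)} (hxy : H.Reachable x y) : G.Reachable x y :=
    hxy.map (SimpleGraph.Embedding.induce _).toHom
  have hinj (x y : V) (hxy : g x = g y) : G.Reachable x y := by
    -- Every vertex is connected in `G` to a representative of the component assigned to it.
    have hrep (x : V) : ∃ z : ({v}ᶜ : Set V), G.Reachable x z ∧ g x = H.connectedComponentMk z := by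
      rcases eq_or_ne x v with rfl | hx
      · exact ⟨p, h.adj_left.reachable, hgv⟩
      by_cases hq : H.Reachable ⟨x, hx⟩ q
      · exact ⟨p, (hval hq).trans (h.adj_right.symm.reachable.trans h.adj_left.reachable),
          hgq ⟨x, hx⟩ hq⟩
      · exact ⟨⟨x, hx⟩, SimpleGraph.Reachable.rfl, hgn ⟨x, hx⟩ hq⟩
    obtain ⟨z, hz, hz'⟩ := hrep x
    obtain ⟨w, hw, hw'⟩ := hrep y
    rw [hz', hw', SimpleGraph.ConnectedComponent.eq] at hxy
    exact hz.trans ((hval hxy).trans hw.symm)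
  have hrange : Set.range g = {H.connectedComponentMk q}ᶜ := by
    ext C
    constructor
    · rintro ⟨x, rfl⟩ hxq
      have hp : H.connectedComponentMk p ≠ H.connectedComponentMk q := fun hpq =>
        h.not_reachable (SimpleGraph.ConnectedComponent.eq.1 hpq)
      rcases eq_or_ne x v with rfl | hx
      · exact hp (hgv ▸ hxq)
      by_cases hq : H.Reachable ⟨x, hx⟩ q
      · exact hp ((hgq ⟨x, hx⟩ hq) ▸ hxq)
      · rw [Set.mem_singleton_iff, hgn ⟨x, hx⟩ hq, SimpleGraph.ConnectedComponent.eq] at hxq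
        exact hq hxq
    · induction C using SimpleGraph.ConnectedComponent.ind with
      | _ x => exact fun hx => ⟨x, hgn x fun hq => hx (SimpleGraph.ConnectedComponent.eq.2 hq)⟩
  let ĝ : G.ConnectedComponent → H.ConnectedComponent := Quot.lift g hreach
  have hĝ : Function.Injective ĝ := by
    rintro ⟨x⟩ ⟨y⟩ hxy
    exact SimpleGraph.ConnectedComponent.eq.2 (hinj x y hxy)
  have hĝr : Set.range ĝ = Set.range g := by
    ext C
    exact ⟨fun ⟨D, hD⟩ => by obtain ⟨x, rfl⟩ := Quot.exists_rep D; exact ⟨x, hD⟩,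
      fun ⟨x, hx⟩ => ⟨Quot.mk _ x, hx⟩⟩
  have hfin : Finite H.ConnectedComponent := Quot.finite _
  have h1 := Set.ncard_range_of_injective hĝ
  have h2 := Set.ncard_add_ncard_compl {H.connectedComponentMk q}
  rw [hĝr, hrange] at h1
  rw [h1, Set.ncard_singleton] at h2
  simp only [numComponents]
  omega

end Splitting

/-- Graphs that reduce to disjoint unions of complete graphs by choosing, again and again, a vertex
`v` whose removal splits its connected component into exactly two, and by passing to `G ∖ v`, `G_v`
and `G_v ∖ v`. Completeness of the connected components is expressed by transitivity of
adjacency. -/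
inductive Splittable : ∀ {V : Type u}, SimpleGraph V → Prop
  | ofTransitive {V : Type u} (G : SimpleGraph V)
      (h : ∀ a b c, G.Adj a b → G.Adj b c → a ≠ c → G.Adj a c) : Splittable G
  | ofSplitsAt {V : Type u} (G : SimpleGraph V) (v : V) (p q : ({v}ᶜ : Set V))
      (splits : SplitsAt G v p q)
      (delete : Splittable (deleteVertex G v))
      (complete : Splittable (completeAt G v))
      (completeDelete : Splittable (deleteVertex (completeAt G v) v)) :
      Splittable G

lemma adj_of_reachable {V : Type u} {G : SimpleGraph V}
    (h : ∀ a b c, G.Adj a b → G.Adj b c → a ≠ c → G.Adj a c) {a b : V} (hab : G.Reachable a b)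
    (hne : a ≠ b) : G.Adj a b := by
  rw [SimpleGraph.reachable_iff_reflTransGen] at hab
  induction hab with
  | refl => exact absurd rfl hne
  | @tail c d _ hcd ih =>
    rcases eq_or_ne a c with rfl | hac
    · exact hcd
    · exact h _ _ _ (ih hac) hcd hne

/-- A set with the cut point property of `G` has this property in `G_v` if it avoids `v`, and
otherwise its other vertices have it in `G ∖ v`; so unmixedness of `G` follows from that of `G_v`
and `G ∖ v`. -/
theorem Splittable.cutSetsUnmixed {V : Type u} {G : SimpleGraph V}
    (hG : Splittable G) (hfin : Finite V) : CutSetsUnmixed G := by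
  induction hG with
  | ofTransitive G h =>
    intro T hT
    rcases T.eq_empty_or_nonempty with rfl | ⟨i, hi⟩
    · rw [numComponents_induce_compl_empty, Set.ncard_empty, add_zero]
    · obtain ⟨a, b, ha, hb, hab⟩ := hT i hi
      refine absurd ?_ hab
      rcases eq_or_ne a b with rfl | hne
      · exact SimpleGraph.Reachable.rfl
      · exact SimpleGraph.Adj.reachable (G := G.induce Tᶜ)
          (h _ _ _ ha.symm hb fun h => hne (Subtype.ext h))
  | ofSplitsAt G v p q splits _ _ _ ihd ihc _ =>
    intro T hT
    by_cases hv : v ∈ T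
    · have h1 := ihd inferInstance _ (hT.deleteVertex hv)
      rw [numComponents_eq_of_iso (deleteVertexInduceIso hv),
        splits.numComponents_deleteVertex] at h1
      have h2 := ncard_eq_ncard_preimage_add_one hv
      omega
    · rw [(completeAt_induce hv).2, ihc hfin T (hT.completeAt hv), numComponents_completeAt]

theorem Splittable.stronglyUnmixed (K : Type v) [Field K] {V : Type u}
    {G : SimpleGraph V} (hG : Splittable G) (hfin : Finite V) : StronglyUnmixed K G := by
  induction hG with
  | ofTransitive G h =>
    refine .ofComplete G fun C => ?_
    ext a b
    refine ⟨fun hab => hab.ne, fun hab => adj_of_reachable h ?_ fun h => hab (Subtype.ext h)⟩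
    exact C.reachable_of_mem_supp a.2 b.2
  | ofSplitsAt G v p q splits hd hc hcd ihd ihc ihcd =>
    refine .ofCutVertex G v
      (Splittable.cutSetsUnmixed (.ofSplitsAt G v p q splits hd hc hcd) hfin).isUnmixed ?_
      (ihd inferInstance) (ihc hfin) (ihcd inferInstance)
    rw [IsCutVertex, splits.numComponents_deleteVertex]
    exact Nat.lt_succ_self _

/-! ### Two cliques sharing a vertex or joined by an edge -/

section CliqueUnions

variable {V : Type u} {G : SimpleGraph V} {A B : Set V} {v : V}

/-- The edges of `G` are exactly the pairs of distinct vertices that lie both in `A` or both in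
`B`. -/
structure IsCliqueUnion (G : SimpleGraph V) (A B : Set V) : Prop where
  left : G.IsClique A
  right : G.IsClique B
  mem_or : ∀ x y, G.Adj x y → (x ∈ A ∧ y ∈ A) ∨ (x ∈ B ∧ y ∈ B)

lemma IsCliqueUnion.deleteVertex (h : IsCliqueUnion G A B) (v : V) :
    IsCliqueUnion (deleteVertex G v) (Subtype.val ⁻¹' A) (Subtype.val ⁻¹' B) where
  left _ hx _ hy hne := h.left hx hy fun h => hne (Subtype.ext h)
  right _ hx _ hy hne := h.right hx hy fun h => hne (Subtype.ext h)
  mem_or x y hxy := h.mem_or x y hxy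

lemma IsCliqueUnion.splittable_of_disjoint (h : IsCliqueUnion G A B) (hd : ∀ x ∈ A, x ∉ B) :
    Splittable G := by
  refine .ofTransitive G fun a b c hab hbc hac => ?_
  rcases h.mem_or a b hab with ⟨ha, hb⟩ | ⟨ha, hb⟩ <;>
    rcases h.mem_or b c hbc with ⟨hb', hc⟩ | ⟨hb', hc⟩
  · exact h.left ha hc hac
  · exact absurd hb' (hd b hb)
  · exact absurd hb (hd b hb')
  · exact h.right ha hc hac

lemma splittable_of_isClique {C : Set V} (hC : G.IsClique C)
    (h : ∀ x y, G.Adj x y → x ∈ C ∧ y ∈ C) : Splittable G :=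
  IsCliqueUnion.splittable_of_disjoint (A := C) (B := ∅)
    ⟨hC, by simp, fun x y hxy => Or.inl (h x y hxy)⟩ (by simp)

lemma not_reachable_of_closed {S : Set V} {x y : V} (hS : ∀ a ∈ S, ∀ b, G.Adj a b → b ∈ S)
    (hx : x ∈ S) (hy : y ∉ S) : ¬ G.Reachable x y := by
  intro h
  rw [SimpleGraph.reachable_iff_reflTransGen] at h
  refine hy ?_
  clear hy
  induction h with
  | refl => exact hx
  | tail _ hbc ih => exact hS _ ih _ hbc

/-- Two cliques that share exactly one vertex: this vertex splits the graph. -/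
lemma IsCliqueUnion.splittable_of_inter_eq_singleton {z : V} (h : IsCliqueUnion G A B)
    (hzA : z ∈ A) (hzB : z ∈ B) (hz : ∀ x ∈ A, x ∈ B → x = z) : Splittable G := by
  by_cases hA : ∃ p ∈ A, p ≠ z
  swap
  · push Not at hA
    refine splittable_of_isClique h.right fun x y hxy => ?_
    rcases h.mem_or x y hxy with ⟨hx, hy⟩ | hxy'
    · exact absurd ((hA x hx).trans (hA y hy).symm) hxy.ne
    · exact hxy'
  by_cases hB : ∃ q ∈ B, q ≠ z
  swap
  · push Not at hB
    refine splittable_of_isClique h.left fun x y hxy => ?_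
    rcases h.mem_or x y hxy with hxy' | ⟨hx, hy⟩
    · exact hxy'
    · exact absurd ((hB x hx).trans (hB y hy).symm) hxy.ne
  obtain ⟨p, hpA, hpz⟩ := hA
  obtain ⟨q, hqB, hqz⟩ := hB
  have hcl : IsCliqueUnion (completeAt G z) (A ∪ B) ∅ := by
    have hadj : ∀ x ∈ A ∪ B, x ≠ z → G.Adj z x := by
      rintro x (hx | hx) hxz
      · exact h.left hzA hx hxz.symm
      · exact h.right hzB hx hxz.symm
    refine ⟨fun x hx y hy hxy => ?_, by simp, fun x y hxy => Or.inl ?_⟩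
    · rcases eq_or_ne x z with rfl | hxz
      · exact Or.inl (hadj y hy hxy.symm)
      rcases eq_or_ne y z with rfl | hyz
      · exact Or.inl (hadj x hx hxy).symm
      exact Or.inr ⟨hxy, hadj x hx hxz, hadj y hy hyz⟩
    · have hmem : ∀ x y, G.Adj x y → x ∈ A ∪ B ∧ y ∈ A ∪ B := fun x y hxy =>
        (h.mem_or x y hxy).elim (fun h => ⟨Or.inl h.1, Or.inl h.2⟩)
          fun h => ⟨Or.inr h.1, Or.inr h.2⟩
      rcases hxy with hxy | ⟨-, hx, hy⟩
      · exact hmem x y hxy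
      · exact ⟨(hmem z x hx).2, (hmem z y hy).2⟩
  refine .ofSplitsAt G z ⟨p, hpz⟩ ⟨q, hqz⟩ ⟨h.left hzA hpA hpz.symm, h.right hzB hqB hqz.symm,
    ?_, ?_⟩ ?_ ?_ ?_
  · refine not_reachable_of_closed (S := Subtype.val ⁻¹' A) (fun a ha b hab => ?_) hpA
      fun hqA => hqz (hz q hqA hqB)
    rcases h.mem_or a b hab with hab' | hab'
    · exact hab'.2
    · exact absurd (hz a ha hab'.1) a.2
  · intro w hw
    rcases h.mem_or z w hw with hw' | hw'
    · by_cases hwp : w = ⟨p, hpz⟩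
      · exact Or.inl (hwp ▸ SimpleGraph.Reachable.rfl)
      · exact Or.inl ((h.deleteVertex z).left hw'.2 hpA hwp).reachable
    · by_cases hwq : w = ⟨q, hqz⟩
      · exact Or.inr (hwq ▸ SimpleGraph.Reachable.rfl)
      · exact Or.inr ((h.deleteVertex z).right hw'.2 hqB hwq).reachable
  · exact (h.deleteVertex z).splittable_of_disjoint fun x hx hx' => x.2 (hz x hx hx')
  · exact hcl.splittable_of_disjoint (by simp)
  · exact (hcl.deleteVertex z).splittable_of_disjoint (by simp)

/-- Two disjoint cliques joined by one edge. -/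
lemma splittable_of_bridge {a b : V} (hA : G.IsClique A) (hB : G.IsClique B)
    (hd : ∀ x ∈ A, x ∉ B) (ha : a ∈ A) (hb : b ∈ B) (hab : G.Adj a b)
    (h : ∀ x y, G.Adj x y →
      (x ∈ A ∧ y ∈ A) ∨ (x ∈ B ∧ y ∈ B) ∨ (x = a ∧ y = b) ∨ (x = b ∧ y = a)) :
    Splittable G := by
  have haB : a ∉ B := hd a ha
  have hbA : b ∉ A := fun h => hd b h hb
  by_cases hA' : ∃ p ∈ A, p ≠ a
  swap
  -- If `A = {a}`, then `a` is no cut vertex, but `{a, b}` and `B` are cliques that share only `b`.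
  · push Not at hA'
    have hU : IsCliqueUnion G {a, b} B := by
      refine ⟨by simpa [SimpleGraph.isClique_pair] using fun _ => hab, hB, fun x y hxy => ?_⟩
      rcases h x y hxy with ⟨hx, hy⟩ | h' | ⟨rfl, rfl⟩ | ⟨rfl, rfl⟩
      · exact absurd ((hA' x hx).trans (hA' y hy).symm) hxy.ne
      · exact Or.inr h'
      · exact Or.inl ⟨by simp, by simp⟩
      · exact Or.inl ⟨by simp, by simp⟩
    refine hU.splittable_of_inter_eq_singleton (z := b) (by simp) hb ?_
    rintro x (rfl | rfl) hx
    · exact absurd hx haB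
    · rfl
  obtain ⟨p, hpA, hpa⟩ := hA'
  have hba : b ≠ a := hab.ne'
  have hnbr : ∀ x, G.Adj a x ↔ x ∈ insert b A ∧ x ≠ a := by
    refine fun x => ⟨fun hx => ⟨?_, hx.ne'⟩, ?_⟩
    · rcases h a x hx with h' | h' | h' | h'
      · exact Or.inr h'.2
      · exact absurd h'.1 haB
      · exact Or.inl h'.2
      · exact absurd h'.1.symm hba
    · rintro ⟨rfl | hx, hxa⟩
      · exact hab
      · exact hA ha hx hxa.symm
  have hU : IsCliqueUnion (completeAt G a) (insert b A) B := by
    refine ⟨fun x hx y hy hxy => ?_, hB.mono (le_completeAt G a), fun x y hxy => ?_⟩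
    · rcases eq_or_ne x a with rfl | hxa
      · exact Or.inl ((hnbr y).2 ⟨hy, hxy.symm⟩)
      rcases eq_or_ne y a with rfl | hya
      · exact Or.inl ((hnbr x).2 ⟨hx, hxy⟩).symm
      exact Or.inr ⟨hxy, (hnbr x).2 ⟨hx, hxa⟩, (hnbr y).2 ⟨hy, hya⟩⟩
    · rcases hxy with hxy | ⟨-, hx, hy⟩
      · rcases h x y hxy with h' | h' | ⟨rfl, rfl⟩ | ⟨rfl, rfl⟩
        · exact Or.inl ⟨Or.inr h'.1, Or.inr h'.2⟩
        · exact Or.inr h'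
        · exact Or.inl ⟨Or.inr ha, Or.inl rfl⟩
        · exact Or.inl ⟨Or.inl rfl, Or.inr ha⟩
      · exact Or.inl ⟨((hnbr x).1 hx).1, ((hnbr y).1 hy).1⟩
  have hinter : ∀ x ∈ insert b A, x ∈ B → x = b := by
    rintro x (rfl | hx) hxB
    · rfl
    · exact absurd hxB (hd x hx)
  have hdel : IsCliqueUnion (deleteVertex G a) (Subtype.val ⁻¹' A) (Subtype.val ⁻¹' B) := by
    refine ⟨fun x hx y hy hxy => hA hx hy fun h => hxy (Subtype.ext h),
      fun x hx y hy hxy => hB hx hy fun h => hxy (Subtype.ext h), fun x y hxy => ?_⟩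
    rcases h x y hxy with h' | h' | h' | h'
    · exact Or.inl h'
    · exact Or.inr h'
    · exact absurd h'.1 x.2
    · exact absurd h'.2 y.2
  refine .ofSplitsAt G a ⟨p, hpa⟩ ⟨b, hba⟩ ⟨hA ha hpA hpa.symm, hab, ?_, ?_⟩ ?_ ?_ ?_
  · refine not_reachable_of_closed (S := Subtype.val ⁻¹' A) (fun x hx y hxy => ?_) hpA hbA
    rcases hdel.mem_or x y hxy with h' | h'
    · exact h'.2
    · exact absurd h'.1 (hd x hx)
  · intro w hw
    rcases ((hnbr w).1 hw).1 with hw' | hw'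
    · have : w = ⟨b, hba⟩ := Subtype.ext hw'
      exact Or.inr (this ▸ SimpleGraph.Reachable.rfl)
    · by_cases hwp : w = ⟨p, hpa⟩
      · exact Or.inl (hwp ▸ SimpleGraph.Reachable.rfl)
      · exact Or.inl (hdel.left hw' hpA hwp).reachable
  · exact hdel.splittable_of_disjoint fun x hx => hd x hx
  · exact hU.splittable_of_inter_eq_singleton (Or.inl rfl) hb hinter
  · exact (hU.deleteVertex a).splittable_of_inter_eq_singleton (z := ⟨b, hba⟩) (Or.inl rfl) hb
      fun x hx hx' => Subtype.ext (hinter x hx hx')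

end CliqueUnions

/-! ### Whiskered cliques -/

section Whiskers

variable {V : Type u} {G : SimpleGraph V} {C A B : Set V} {a b v f : V}

/-- A vertex is whiskered, relative to a core `C` of the graph, if it has a neighbour outside the
core. -/
def Whiskered (G : SimpleGraph V) (C : Set V) (w : V) : Prop := ∃ f ∉ C, G.Adj w f

/-- `G` arises from its induced subgraph on `C` by attaching at most one whisker at each vertex and
by adding isolated vertices; moreover `a` and `b` are adjacent vertices of `C` without whiskers such
that every vertex of `C` is equal or adjacent to one of them. -/
structure IsWhiskerCore (G : SimpleGraph V) (C : Set V) (a b : V) : Prop where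
  nbr_mem : ∀ f ∉ C, ∀ x, G.Adj f x → x ∈ C
  nbr_unique : ∀ f ∉ C, ∀ x y, G.Adj f x → G.Adj f y → x = y
  whisker_unique : ∀ w ∈ C, ∀ f ∉ C, ∀ g ∉ C, G.Adj w f → G.Adj w g → f = g
  left_mem : a ∈ C
  right_mem : b ∈ C
  adj : G.Adj a b
  left_not : ¬ Whiskered G C a
  right_not : ¬ Whiskered G C b
  dom : ∀ x ∈ C, x = a ∨ x = b ∨ G.Adj x a ∨ G.Adj x b

/-- The core `C` is the union of the cliques `A ∋ a` and `B ∋ b`; all common vertices of `A` and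
`B` are whiskered, and so are both ends of every edge between them, with the exception of the edge
`{a, b}`. -/
structure IsCliquePair (G : SimpleGraph V) (C A B : Set V) (a b : V) : Prop where
  union : ∀ x, x ∈ C ↔ x ∈ A ∨ x ∈ B
  left : G.IsClique A
  right : G.IsClique B
  left_mem : a ∈ A
  right_mem : b ∈ B
  inter : ∀ x ∈ A, x ∈ B → Whiskered G C x
  edge : ∀ x ∈ A, ∀ y ∈ B, G.Adj x y →
    y ∈ A ∨ x ∈ B ∨ (Whiskered G C x ∧ Whiskered G C y) ∨ (x = a ∧ y = b)

lemma IsCliquePair.symm (h : IsCliquePair G C A B a b) : IsCliquePair G C B A b a where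
  union x := (h.union x).trans or_comm
  left := h.right
  right := h.left
  left_mem := h.right_mem
  right_mem := h.left_mem
  inter x hx hx' := h.inter x hx' hx
  edge x hx y hy hxy := by
    rcases h.edge y hy x hx hxy.symm with h' | h' | h' | h'
    · exact Or.inr (Or.inl h')
    · exact Or.inl h'
    · exact Or.inr (Or.inr (Or.inl h'.symm))
    · exact Or.inr (Or.inr (Or.inr h'.symm))

/-- The class of graphs through which the recursion runs: whiskers attached to a clique or to a pair
of cliques. -/
structure IsWhiskeredCliques (G : SimpleGraph V) (C : Set V) (a b : V) : Prop where
  core : IsWhiskerCore G C a b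
  cliques : G.IsClique C ∨ ∃ A B, IsCliquePair G C A B a b

lemma whiskered_deleteVertex_iff (hv : v ∈ C) {w : ({v}ᶜ : Set V)} :
    Whiskered (deleteVertex G v) (Subtype.val ⁻¹' C) w ↔ Whiskered G C w := by
  constructor
  · rintro ⟨f, hf, hwf⟩
    exact ⟨f, hf, hwf⟩
  · rintro ⟨f, hf, hwf⟩
    exact ⟨⟨f, fun h : f = v => hf (h ▸ hv)⟩, hf, hwf⟩

lemma IsWhiskeredCliques.deleteVertex (h : IsWhiskeredCliques G C a b) (hv : v ∈ C)
    (ha : a ≠ v) (hb : b ≠ v) :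
    IsWhiskeredCliques (deleteVertex G v) (Subtype.val ⁻¹' C) ⟨a, ha⟩ ⟨b, hb⟩ where
  core :=
    { nbr_mem := fun f hf x hx => h.core.nbr_mem f hf x hx
      nbr_unique := fun f hf x y hx hy => Subtype.ext (h.core.nbr_unique f hf x y hx hy)
      whisker_unique := fun w hw f hf g hg hwf hwg =>
        Subtype.ext (h.core.whisker_unique w hw f hf g hg hwf hwg)
      left_mem := h.core.left_mem
      right_mem := h.core.right_mem
      adj := h.core.adj
      left_not := fun h' => h.core.left_not ((whiskered_deleteVertex_iff hv).1 h')
      right_not := fun h' => h.core.right_not ((whiskered_deleteVertex_iff hv).1 h')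
      dom := fun x hx => (h.core.dom x hx).imp (fun h => Subtype.ext h)
        fun h => h.imp_left fun h => Subtype.ext h }
  cliques := by
    rcases h.cliques with hC | ⟨A, B, hAB⟩
    · exact Or.inl fun x hx y hy hxy => hC hx hy fun h => hxy (Subtype.ext h)
    · refine Or.inr ⟨Subtype.val ⁻¹' A, Subtype.val ⁻¹' B, ⟨fun x => hAB.union x,
        fun x hx y hy hxy => hAB.left hx hy fun h => hxy (Subtype.ext h),
        fun x hx y hy hxy => hAB.right hx hy fun h => hxy (Subtype.ext h),
        hAB.left_mem, hAB.right_mem,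
        fun x hx hx' => (whiskered_deleteVertex_iff hv).2 (hAB.inter x hx hx'),
        fun x hx y hy hxy => ?_⟩⟩
      rcases hAB.edge x hx y hy hxy with h' | h' | h' | h'
      · exact Or.inl h'
      · exact Or.inr (Or.inl h')
      · exact Or.inr (Or.inr (Or.inl ⟨(whiskered_deleteVertex_iff hv).2 h'.1,
          (whiskered_deleteVertex_iff hv).2 h'.2⟩))
      · exact Or.inr (Or.inr (Or.inr ⟨Subtype.ext h'.1, Subtype.ext h'.2⟩))

/-- In `G_v` the whisker `f` of `v` becomes part of the core, and no other vertex outside the core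
gets a new neighbour. -/
lemma IsWhiskerCore.completeAt_adj_iff (h : IsWhiskerCore G C a b) (hv : v ∈ C) (hf : f ∉ C)
    (hvf : G.Adj v f) {g x : V} (hg : g ∉ insert f C) :
    (completeAt G v).Adj g x ↔ G.Adj g x := by
  refine ⟨?_, Or.inl⟩
  rintro (h' | ⟨-, h', -⟩)
  · exact h'
  · exact absurd (Or.inl (h.whisker_unique v hv g (fun h => hg (Or.inr h)) f hf h' hvf)) hg

lemma IsWhiskerCore.whiskered_completeAt_iff (h : IsWhiskerCore G C a b) (hv : v ∈ C) (hf : f ∉ C)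
    (hvf : G.Adj v f) {w : V} :
    Whiskered (completeAt G v) (insert f C) w ↔ Whiskered G C w ∧ w ≠ v ∧ w ∈ C := by
  constructor
  · rintro ⟨g, hg, hwg⟩
    have hwg' := (h.completeAt_adj_iff hv hf hvf hg).1 hwg.symm
    have hgC : g ∉ C := fun h => hg (Or.inr h)
    refine ⟨⟨g, hgC, hwg'.symm⟩, ?_, h.nbr_mem g hgC w hwg'⟩
    rintro rfl
    exact hg (Or.inl (h.whisker_unique w hv g hgC f hf hwg'.symm hvf))
  · rintro ⟨⟨g, hg, hwg⟩, hwv, hw⟩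
    refine ⟨g, ?_, Or.inl hwg⟩
    rintro (rfl | hg')
    · exact hwv (h.nbr_unique g hf w v hwg.symm hvf.symm)
    · exact hg hg'

lemma IsWhiskerCore.completeAt (h : IsWhiskerCore G C a b) (hv : v ∈ C) (hf : f ∉ C)
    (hvf : G.Adj v f) : IsWhiskerCore (completeAt G v) (insert f C) a b := by
  have hadj {g x : V} (hg : g ∉ insert f C) : (BinomialEdge.completeAt G v).Adj g x → G.Adj g x :=
    (h.completeAt_adj_iff hv hf hvf hg).1
  have hC {g : V} (hg : g ∉ insert f C) : g ∉ C := fun h => hg (Or.inr h)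
  refine ⟨fun g hg x hx => Or.inr (h.nbr_mem g (hC hg) x (hadj hg hx)),
    fun g hg x y hx hy => h.nbr_unique g (hC hg) x y (hadj hg hx) (hadj hg hy), ?_,
    Or.inr h.left_mem, Or.inr h.right_mem, Or.inl h.adj, ?_, ?_, ?_⟩
  · intro w _ g hg g' hg' hwg hwg'
    have hgw := hadj hg hwg.symm
    exact h.whisker_unique w (h.nbr_mem g (hC hg) w hgw) g (hC hg) g' (hC hg') hgw.symm
      (hadj hg' hwg'.symm).symm
  · exact fun h' => h.left_not ((h.whiskered_completeAt_iff hv hf hvf).1 h').1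
  · exact fun h' => h.right_not ((h.whiskered_completeAt_iff hv hf hvf).1 h').1
  · rintro x (rfl | hx)
    · have hav : a ≠ v := fun h' => h.left_not ⟨x, hf, h' ▸ hvf⟩
      have hbv : b ≠ v := fun h' => h.right_not ⟨x, hf, h' ▸ hvf⟩
      rcases h.dom v hv with h' | h' | h' | h'
      · exact absurd h'.symm hav
      · exact absurd h'.symm hbv
      · exact Or.inr (Or.inr (Or.inl (Or.inr ⟨fun h' => hf (h' ▸ h.left_mem), hvf, h'⟩)))
      · exact Or.inr (Or.inr (Or.inr (Or.inr ⟨fun h' => hf (h' ▸ h.right_mem), hvf, h'⟩)))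
    · exact (h.dom x hx).imp_right fun h => h.imp_right fun h => h.imp Or.inl Or.inl

lemma isClique_completeAt {S : Set V} (hS : ∀ x ∈ S, x ≠ v → G.Adj v x) :
    (completeAt G v).IsClique S := by
  intro x hx y hy hxy
  rcases eq_or_ne x v with rfl | hxv
  · exact Or.inl (hS y hy hxy.symm)
  rcases eq_or_ne y v with rfl | hyv
  · exact Or.inl (hS x hx hxv).symm
  exact Or.inr ⟨hxy, hS x hx hxv, hS y hy hyv⟩

/-- If the whiskered vertex `v` lies in `A` only, then in `G_v` the clique `A` grows by the whisker
of `v` and by the neighbours of `v` in `B`. The latter are whiskered, so that the conditions on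
common vertices persist. -/
lemma IsCliquePair.completeAt (h : IsWhiskerCore G C a b) (hAB : IsCliquePair G C A B a b)
    (hvA : v ∈ A) (hvB : v ∉ B) (hf : f ∉ C) (hvf : G.Adj v f) :
    IsCliquePair (completeAt G v) (insert f C) (insert f (A ∪ {x | x ∈ C ∧ G.Adj v x})) B a b := by
  have hv : v ∈ C := (hAB.union v).2 (Or.inl hvA)
  have hva : v ≠ a := fun h' => h.left_not ⟨f, hf, h' ▸ hvf⟩
  have hBC {x : V} (hx : x ∈ B) : x ∈ C := (hAB.union x).2 (Or.inr hx)
  have hw {x : V} (hx : x ∈ C) (hxv : x ≠ v) (hxw : Whiskered G C x) :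
      Whiskered (BinomialEdge.completeAt G v) (insert f C) x :=
    (h.whiskered_completeAt_iff hv hf hvf).2 ⟨hxw, hxv, hx⟩
  have hne {x : V} (hx : x ∈ B) : x ≠ v := fun h => hvB (h ▸ hx)
  refine ⟨fun x => ?_, isClique_completeAt ?_, hAB.right.mono (le_completeAt G v),
    Or.inr (Or.inl hAB.left_mem), hAB.right_mem, ?_, ?_⟩
  · simp only [Set.mem_insert_iff, Set.mem_union, Set.mem_ofPred_eq, hAB.union x]
    tauto
  · rintro x (rfl | hx | hx) hxv
    · exact hvf
    · exact hAB.left hvA hx hxv.symm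
    · exact hx.2
  · rintro x (rfl | hx | hx) hxB
    · exact absurd (hBC hxB) hf
    · exact hw (hBC hxB) (hne hxB) (hAB.inter x hx hxB)
    · refine hw hx.1 (hne hxB) ?_
      rcases hAB.edge v hvA x hxB hx.2 with h' | h' | h' | h'
      · exact hAB.inter x h' hxB
      · exact absurd h' hvB
      · exact h'.2
      · exact absurd h'.1 hva
  · intro x hx y hy hxy
    rcases hxy with hxy | ⟨-, -, hvy⟩
    swap
    · exact Or.inl (Or.inr (Or.inr ⟨hBC hy, hvy⟩))
    have hxA : x ∈ A ∨ x ∈ B := by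
      rcases hx with rfl | hx | hx
      · exact absurd (h.nbr_unique x hf y v hxy hvf.symm) (hne hy)
      · exact Or.inl hx
      · exact (hAB.union x).1 hx.1
    rcases hxA with hxA | hxB
    swap
    · exact Or.inr (Or.inl hxB)
    rcases eq_or_ne x v with rfl | hxv
    · exact Or.inl (Or.inr (Or.inr ⟨hBC hy, hxy⟩))
    rcases hAB.edge x hxA y hy hxy with h' | h' | h' | h'
    · exact Or.inl (Or.inr (Or.inl h'))
    · exact Or.inr (Or.inl h')
    · exact Or.inr (Or.inr (Or.inl ⟨hw ((hAB.union x).2 (Or.inl hxA)) hxv h'.1,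
        hw (hBC hy) (hne hy) h'.2⟩))
    · exact Or.inr (Or.inr (Or.inr h'))

lemma IsWhiskeredCliques.completeAt (h : IsWhiskeredCliques G C a b) (hv : v ∈ C) (hf : f ∉ C)
    (hvf : G.Adj v f) : IsWhiskeredCliques (completeAt G v) (insert f C) a b := by
  refine ⟨h.core.completeAt hv hf hvf, ?_⟩
  have hclique (hC : ∀ x ∈ C, x ≠ v → G.Adj v x) :
      (BinomialEdge.completeAt G v).IsClique (insert f C) := by
    refine isClique_completeAt ?_
    rintro x (rfl | hx) hxv
    · exact hvf
    · exact hC x hx hxv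
  rcases h.cliques with hC | ⟨A, B, hAB⟩
  · exact Or.inl (hclique fun x hx hxv => hC hv hx hxv.symm)
  by_cases hvA : v ∈ A
  · by_cases hvB : v ∈ B
    · refine Or.inl (hclique fun x hx hxv => ?_)
      rcases (hAB.union x).1 hx with hx | hx
      · exact hAB.left hvA hx hxv.symm
      · exact hAB.right hvB hx hxv.symm
    · exact Or.inr ⟨_, _, IsCliquePair.completeAt h.core hAB hvA hvB hf hvf⟩
  · have hvB : v ∈ B := ((hAB.union v).1 hv).resolve_left hvA
    have hsymm : IsWhiskerCore G C b a :=
      { h.core with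
        left_mem := h.core.right_mem
        right_mem := h.core.left_mem
        adj := h.core.adj.symm
        left_not := h.core.right_not
        right_not := h.core.left_not
        dom := fun x hx => by have := h.core.dom x hx; tauto }
    exact Or.inr ⟨_, _, (IsCliquePair.completeAt hsymm hAB.symm hvB hvA hf hvf).symm⟩

/-- Removing a whiskered vertex cuts off its whisker, while the rest of the core stays connected
through the edge `{a, b}`. -/
lemma IsWhiskerCore.exists_splitsAt (h : IsWhiskerCore G C a b) (hv : v ∈ C) (hf : f ∉ C)
    (hvf : G.Adj v f) : ∃ q, SplitsAt G v ⟨f, hvf.ne'⟩ q := by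
  have hav : a ≠ v := fun h' => h.left_not ⟨f, hf, h' ▸ hvf⟩
  have hbv : b ≠ v := fun h' => h.right_not ⟨f, hf, h' ▸ hvf⟩
  have hab : (deleteVertex G v).Adj ⟨a, hav⟩ ⟨b, hbv⟩ := h.adj
  have hreach (x : ({v}ᶜ : Set V)) (hx : (x : V) ∈ C) :
      (deleteVertex G v).Reachable x ⟨a, hav⟩ := by
    rcases h.dom x hx with h' | h' | h' | h'
    · have : x = ⟨a, hav⟩ := Subtype.ext h'
      exact this ▸ SimpleGraph.Reachable.rfl
    · have : x = ⟨b, hbv⟩ := Subtype.ext h'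
      exact this ▸ hab.symm.reachable
    · exact SimpleGraph.Adj.reachable (G := deleteVertex G v) (v := ⟨a, hav⟩) h'
    · exact (SimpleGraph.Adj.reachable (G := deleteVertex G v) (v := ⟨b, hbv⟩) h').trans
        hab.symm.reachable
  obtain ⟨q, hq, hvq⟩ : ∃ q ∈ C, G.Adj v q := by
    rcases h.dom v hv with h' | h' | h' | h'
    · exact absurd h'.symm hav
    · exact absurd h'.symm hbv
    · exact ⟨a, h.left_mem, h'⟩
    · exact ⟨b, h.right_mem, h'⟩
  refine ⟨⟨q, hvq.ne'⟩, hvf, hvq, ?_, fun w hw => ?_⟩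
  · refine not_reachable_of_closed (S := {⟨f, hvf.ne'⟩}) ?_ rfl fun h' => hf ?_
    · rintro x rfl y hxy
      exact absurd (h.nbr_unique f hf y v hxy hvf.symm) y.2
    · have := congrArg Subtype.val (Set.mem_singleton_iff.1 h')
      simp only at this
      exact this ▸ hq
  · by_cases hwC : (w : V) ∈ C
    · exact Or.inr ((hreach w hwC).trans (hreach ⟨q, hvq.ne'⟩ hq).symm)
    · have : w = ⟨f, hvf.ne'⟩ := Subtype.ext (h.whisker_unique v hv w hwC f hf hw hvf)
      exact Or.inl (this ▸ SimpleGraph.Reachable.rfl)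

/-- Without whiskers, only isolated vertices lie outside the core, and the core is a clique or two
disjoint cliques joined by an edge. -/
lemma IsWhiskeredCliques.splittable_of_not_whiskered (h : IsWhiskeredCliques G C a b)
    (hw : ∀ w ∈ C, ¬ Whiskered G C w) : Splittable G := by
  have hmem (x y : V) (hxy : G.Adj x y) : x ∈ C := by
    by_contra hx
    exact hw y (h.core.nbr_mem x hx y hxy) ⟨x, hx, hxy.symm⟩
  rcases h.cliques with hC | ⟨A, B, hAB⟩
  · exact splittable_of_isClique hC fun x y hxy => ⟨hmem x y hxy, hmem y x hxy.symm⟩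
  have hedge (x y : V) (hx : x ∈ A) (hy : y ∈ B) (hxy : G.Adj x y) :
      y ∈ A ∨ x ∈ B ∨ (x = a ∧ y = b) := by
    rcases hAB.edge x hx y hy hxy with h' | h' | h' | h'
    · exact Or.inl h'
    · exact Or.inr (Or.inl h')
    · exact absurd h'.1 (hw x ((hAB.union x).2 (Or.inl hx)))
    · exact Or.inr (Or.inr h')
  refine splittable_of_bridge hAB.left hAB.right
    (fun x hx hx' => hw x ((hAB.union x).2 (Or.inl hx)) (hAB.inter x hx hx'))
    hAB.left_mem hAB.right_mem h.core.adj fun x y hxy => ?_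
  rcases (hAB.union x).1 (hmem x y hxy) with hx | hx <;>
    rcases (hAB.union y).1 (hmem y x hxy.symm) with hy | hy
  · exact Or.inl ⟨hx, hy⟩
  · have := hedge x y hx hy hxy
    tauto
  · have := hedge y x hy hx hxy.symm
    tauto
  · exact Or.inr (Or.inl ⟨hx, hy⟩)

lemma card_compl_singleton_add_one [Finite V] (v : V) :
    Nat.card ({v}ᶜ : Set V) + 1 = Nat.card V := by
  have := Set.ncard_add_ncard_compl {v}
  rw [Set.ncard_singleton] at this
  rw [Nat.card_coe_set_eq]
  omega

lemma ncard_compl_preimage_le [Finite V] (v : V) (C : Set V) :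
    (Subtype.val ⁻¹' C : Set ({v}ᶜ : Set V))ᶜ.ncard ≤ Cᶜ.ncard := by
  rw [← Set.ncard_image_of_injective _ Subtype.val_injective]
  refine Set.ncard_le_ncard ?_
  rintro _ ⟨x, hx, rfl⟩
  exact hx

/-- Whiskered vertices are used as splitting vertices until none is left. Passing to `G ∖ v` lowers
the number of vertices, and passing to `G_v` lowers the number of vertices outside the core. -/
theorem IsWhiskeredCliques.splittable {V : Type u} [Finite V] {G : SimpleGraph V} {C : Set V}
    {a b : V} (h : IsWhiskeredCliques G C a b) : Splittable G := by
  suffices ∀ n : ℕ, ∀ {V : Type u} [Finite V] {G : SimpleGraph V} {C : Set V} {a b : V},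
      IsWhiskeredCliques G C a b → Nat.card V + Cᶜ.ncard = n → Splittable G from this _ h rfl
  intro n
  induction n using Nat.strong_induction_on with
  | _ n ih =>
    intro V _ G C a b h hn
    by_cases hw : ∀ w ∈ C, ¬ Whiskered G C w
    · exact h.splittable_of_not_whiskered hw
    push Not at hw
    obtain ⟨v, hv, f, hf, hvf⟩ := hw
    obtain ⟨q, hq⟩ := h.core.exists_splitsAt hv hf hvf
    have hav : a ≠ v := fun h' => h.core.left_not ⟨f, hf, h' ▸ hvf⟩
    have hbv : b ≠ v := fun h' => h.core.right_not ⟨f, hf, h' ▸ hvf⟩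
    have hc := h.completeAt hv hf hvf
    have h1 := card_compl_singleton_add_one v
    have h2 := ncard_compl_preimage_le v C
    have h3 := ncard_compl_preimage_le v (insert f C)
    have h4 : (insert f C)ᶜ.ncard < Cᶜ.ncard :=
      Set.ncard_lt_ncard (compl_lt_compl_iff_lt.2 (Set.ssubset_insert hf))
    refine .ofSplitsAt G v _ q hq (ih _ ?_ (h.deleteVertex hv hav hbv) rfl) (ih _ ?_ hc rfl)
      (ih _ ?_ (hc.deleteVertex (Or.inr hv) hav hbv) rfl) <;> omega

end Whiskers

/-! ### The whiskered star product -/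

section StarProduct

lemma whiskered_range_inl_iff {V : Type u} {G : SimpleGraph V} {W : Set V} {x : V} :
    Whiskered (attachWhiskers G W) (Set.range Sum.inl) (Sum.inl x) ↔ x ∈ W := by
  constructor
  · rintro ⟨y | w, hf, h⟩
    · exact absurd ⟨y, rfl⟩ hf
    · have h' : x = w := h
      exact h' ▸ w.2
  · exact fun hx => ⟨Sum.inr ⟨x, hx⟩, by simp, rfl⟩

/-- The core consists of all vertices of the star product, and its unwhiskered edge is
`{x_1, y_1}`. -/
lemma isWhiskeredCliques_whiskeredStarProduct {m n r : ℕ} (hm : 0 < m) (hn : 0 < n) (hr : 0 < r) :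
    IsWhiskeredCliques (whiskeredStarProduct m n r) (Set.range Sum.inl)
      (Sum.inl (Sum.inl ⟨0, hm⟩)) (Sum.inl (Sum.inr ⟨0, hn⟩)) where
  core :=
    { nbr_mem := by
        rintro (x | w) hf (y | w') h
        · exact ⟨y, rfl⟩
        · exact absurd ⟨x, rfl⟩ hf
        · exact ⟨y, rfl⟩
        · exact h.elim
      nbr_unique := by
        rintro (x | w) hf
        · exact absurd ⟨x, rfl⟩ hf
        rintro (y | w') (z | w'') hy hz
        · exact congrArg Sum.inl (Eq.trans (b := (w : Fin m ⊕ Fin n)) hy (Eq.symm hz))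
        · exact hz.elim
        · exact hy.elim
        · exact hy.elim
      whisker_unique := by
        rintro _ ⟨x, rfl⟩ (y | w) hf
        · exact absurd ⟨y, rfl⟩ hf
        rintro (z | w') hg hy hz
        · exact absurd ⟨z, rfl⟩ hg
        · exact congrArg Sum.inr (Subtype.ext (Eq.trans (b := x) (Eq.symm hy) hz))
      left_mem := ⟨_, rfl⟩
      right_mem := ⟨_, rfl⟩
      adj := ⟨rfl, hr⟩
      left_not := fun h => by
        have := whiskered_range_inl_iff.1 h
        simp [whiskerVertices] at this
      right_not := fun h => by
        have := whiskered_range_inl_iff.1 h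
        simp [whiskerVertices] at this
      dom := by
        rintro _ ⟨i | i, rfl⟩
        · by_cases hi : i = ⟨0, hm⟩
          · exact Or.inl (by rw [hi])
          · exact Or.inr (Or.inr (Or.inl hi))
        · by_cases hi : i = ⟨0, hn⟩
          · exact Or.inr (Or.inl (by rw [hi]))
          · exact Or.inr (Or.inr (Or.inr hi)) }
  cliques := by
    refine Or.inr ⟨Set.range fun i => Sum.inl (Sum.inl i), Set.range fun j => Sum.inl (Sum.inr j),
      ⟨?_, ?_, ?_, ⟨_, rfl⟩, ⟨_, rfl⟩, ?_, ?_⟩⟩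
    · rintro ((i | j) | w) <;> simp
    · rintro _ ⟨i, rfl⟩ _ ⟨j, rfl⟩ hij
      exact fun h => hij (by rw [h])
    · rintro _ ⟨i, rfl⟩ _ ⟨j, rfl⟩ hij
      exact fun h => hij (by rw [h])
    · rintro _ ⟨i, rfl⟩ ⟨j, hj⟩
      simp at hj
    · rintro _ ⟨i, rfl⟩ _ ⟨j, rfl⟩ hij
      obtain ⟨hij, hir⟩ : i.val = j.val ∧ i.val < r := hij
      rcases Nat.eq_zero_or_pos i.val with hi | hi
      · exact Or.inr (Or.inr (Or.inr ⟨congrArg (fun i => Sum.inl (Sum.inl i)) (Fin.ext hi),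
          congrArg (fun j => Sum.inl (Sum.inr j)) (Fin.ext (hij ▸ hi))⟩))
      · exact Or.inr (Or.inr (Or.inl ⟨whiskered_range_inl_iff.2 ⟨hi, hir⟩,
          whiskered_range_inl_iff.2 ⟨hij ▸ hi, hij ▸ hir⟩⟩))

end StarProduct

end BinomialEdge

theorem mainTheorem6 (K : Type*) [Field K] (m n r : ℕ) (hr : 1 ≤ r) (hrm : r ≤ m) (hrn : r ≤ n) :
    BinomialEdge.StronglyUnmixed K (BinomialEdge.whiskeredStarProduct m n r) :=
  (BinomialEdge.isWhiskeredCliques_whiskeredStarProduct (hr.trans hrm) (hr.trans hrn)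
    hr).splittable.stronglyUnmixed K inferInstance
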